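/- Let $N\ge 1$, $0<s<1<p<N/s$, and put $$\|u\|_{s,p}^p=\int_{\mathbb R^N\times\mathbb R^N}\frac{|u(x)-u(y)|^p}{|x-y|^{N+sp}}\,dx\,dy .$$ Let $\mathcal D^{s,p}(\mathbb R^N)$ be the completion of $C_c^1(\mathbb R^N)$ with respect to $\|\cdot\|_{s,p}$, realised as a space of functions in $L^{Np/(N-sp)}(\mathbb R^N)$. For bounded measurable $F\subset\mathbb R^N$ let $$\mathrm{Cap}_{s,p}(F)=\inf\{\|u\|_{s,p}^p : u\in\mathcal D^{s,p}(\mathbb R^N),\ u\ge 1\text{ a.e. in }F\},$$ let $\|w\|_{\mathcal H_{s,p}}=\sup_F \int_F|w|\,dx\,/\,\mathrm{Cap}_{s,p}(F)$, the supremum being over all bounded measurable $F$ of positive measure, let $\mathcal H_{s,p}(\mathbb R^N)=\{w\in L^1_{loc}(\mathbb R^N):\|w\|_{\mathcal H_{s,p}}<\infty\}$, and let $\mathcal H_{s,p,0}(\mathbb R^N)$ be the closure of $C_c(\mathbb R^N)$ in $\mathcal H_{s,p}(\mathbb R^N)$. Let $w=w_1-w_2$ with $w_1,w_2\ge 0$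 a.e., $w_1\in\mathcal H_{s,p,0}(\mathbb R^N)$ and $w_2\in L^1_{loc}(\mathbb R^N)$. An eigenfunction of $$(-\Delta_p)^s u=\lambda\, w\,|u|^{p-2}u\quad\text{in }\mathbb R^N$$ for $\lambda\in\mathbb R$ is a function $u\in\mathcal D^{s,p}(\mathbb R^N)$, not a.e. equal to $0$, such that for all $v\in\mathcal D^{s,p}(\mathbb R^N)$ the function $w|u|^{p-2}uv$ is integrable and $$\int_{\mathbb R^N\times\mathbb R^N}\frac{|u(x)-u(y)|^{p-2}(u(x)-u(y))(v(x)-v(y))}{|x-y|^{N+sp}}\,dx\,dy=\lambda\int_{\mathbb R^N}w|u|^{p-2}uv\,dx .$$ Let $\lambda_1=\inf\{\|u\|_{s,p}^p : u\in\mathcal D^{s,p}(\mathbb R^N),\ w|u|^p\in L^1(\mathbb R^N),\ \int_{\mathbb R^N}w|u|^p\,dx=1\}$ (with $\inf\emptyset=+\infty$). A first eigenfunction is an eigenfunction for $\lambda=\lambda_1<\infty$. Then: 1. Every first eigenfunction has constant sign: $u\ge 0$ a.e. or $u\le 0$ a.e. in $\mathbb R^N$. 2. A first eigenfunction $u$ with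 $u\ge 0$ a.e. satisfies $u>0$ a.e. in $\mathbb R^N$. 3. $\lambda_1$ is simple: if $u$ and $v$ are first eigenfunctions, then $u=cv$ a.e. in $\mathbb R^N$ for some constant $c\ne 0$. -/

import Mathlib

open MeasureTheory Filter Topology
open scoped ENNReal

namespace FracHardy

/-- The `p`-th power of the Gagliardo seminorm,
`∬ |u(x) - u(y)|^p / |x - y|^(N + s p) dx dy`, with values in `[0, ∞]`. -/
noncomputable def energy {N : ℕ} (s p : ℝ) (u : EuclideanSpace ℝ (Fin N) → ℝ) : ℝ≥0∞ :=
  ∫⁻ z : EuclideanSpace ℝ (Fin N) × EuclideanSpace ℝ (Fin N),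
    ENNReal.ofReal (|u z.1 - u z.2| ^ p / ‖z.1 - z.2‖ ^ ((N : ℝ) + s * p))

/-- The fractional critical Sobolev exponent `N p / (N - s p)`. -/
noncomputable def critExp (N : ℕ) (s p : ℝ) : ℝ≥0∞ :=
  ENNReal.ofReal ((N : ℝ) * p / ((N : ℝ) - s * p))

/-- The space `D^{s,p}(ℝ^N)`, the completion of `C_c^1(ℝ^N)` for the Gagliardo seminorm, as a space
of functions: `u` is the limit of a sequence in `C_c^1(ℝ^N)` in the seminorm and in the critical
Lebesgue space (for `s p < N` a sequence in `C_c^1` that is Cauchy for the seminorm also converges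
in the critical Lebesgue space, by the fractional Sobolev inequality, and its limit there is the
function that represents its class in the completion). -/
def MemD {N : ℕ} (s p : ℝ) (u : EuclideanSpace ℝ (Fin N) → ℝ) : Prop :=
  AEStronglyMeasurable u volume ∧
  ∃ φ : ℕ → EuclideanSpace ℝ (Fin N) → ℝ,
    (∀ n, ContDiff ℝ 1 (φ n) ∧ HasCompactSupport (φ n)) ∧
    Tendsto (fun n => energy s p (φ n - u)) atTop (𝓝 0) ∧
    Tendsto (fun n => eLpNorm (φ n - u) (critExp N s p) volume) atTop (𝓝 0)

/-- The `(s,p)`-capacity of `F` relative to `ℝ^N`. -/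
noncomputable def cap {N : ℕ} (s p : ℝ) (F : Set (EuclideanSpace ℝ (Fin N))) : ℝ≥0∞ :=
  ⨅ (u : EuclideanSpace ℝ (Fin N) → ℝ) (_ : MemD s p u ∧ ∀ᵐ x ∂volume, x ∈ F → 1 ≤ u x),
    energy s p u

/-- The norm `sup_F (∫_F |w|) / Cap_{s,p}(F)` over relatively compact (that is, bounded) measurable
sets `F`; null sets contribute `0 / 0 = 0`. -/
noncomputable def hardyNorm {N : ℕ} (s p : ℝ) (w : EuclideanSpace ℝ (Fin N) → ℝ) : ℝ≥0∞ :=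
  ⨆ (F : Set (EuclideanSpace ℝ (Fin N))) (_ : MeasurableSet F ∧ Bornology.IsBounded F),
    (∫⁻ x in F, ‖w x‖ₑ) / cap s p F

/-- The space `H_{s,p}(ℝ^N)` of `(s,p)`-Hardy potentials. -/
def MemHardy {N : ℕ} (s p : ℝ) (w : EuclideanSpace ℝ (Fin N) → ℝ) : Prop :=
  LocallyIntegrable w volume ∧ hardyNorm s p w < ∞

/-- The space `H_{s,p,0}(ℝ^N)`, the closure of `C_c(ℝ^N)` in `H_{s,p}(ℝ^N)`. -/
def MemHardyZero {N : ℕ} (s p : ℝ) (w : EuclideanSpace ℝ (Fin N) → ℝ) : Prop :=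
  MemHardy s p w ∧
  ∀ ε : ℝ≥0∞, 0 < ε → ∃ φ : EuclideanSpace ℝ (Fin N) → ℝ,
    Continuous φ ∧ HasCompactSupport φ ∧ hardyNorm s p (w - φ) < ε

/-- `u` is an eigenfunction of `(-Δ_p)^s u = lam w |u|^(p-2) u` in `ℝ^N` for the eigenvalue `lam`:
it is a nonzero element of `D^{s,p}` and satisfies the weak equation (whose right-hand side is
required to be an absolutely convergent integral) for all test functions in `D^{s,p}`. -/
def IsEigenfunction {N : ℕ} (s p : ℝ) (w : EuclideanSpace ℝ (Fin N) → ℝ) (lam : ℝ)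
    (u : EuclideanSpace ℝ (Fin N) → ℝ) : Prop :=
  MemD s p u ∧ ¬ (u =ᵐ[volume] 0) ∧
  ∀ v : EuclideanSpace ℝ (Fin N) → ℝ, MemD s p v →
    Integrable (fun x => w x * (|u x| ^ (p - 2) * u x) * v x) volume ∧
    ∫ z : EuclideanSpace ℝ (Fin N) × EuclideanSpace ℝ (Fin N),
        |u z.1 - u z.2| ^ (p - 2) * (u z.1 - u z.2) * (v z.1 - v z.2)
          / ‖z.1 - z.2‖ ^ ((N : ℝ) + s * p)
      = lam * ∫ x, w x * (|u x| ^ (p - 2) * u x) * v x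

/-- `inf { ‖u‖_{s,p}^p : u ∈ D^{s,p}, ∫ w |u|^p = 1 }`, with `inf ∅ = ∞`. -/
noncomputable def firstEigenvalue {N : ℕ} (s p : ℝ) (w : EuclideanSpace ℝ (Fin N) → ℝ) : ℝ≥0∞ :=
  ⨅ (u : EuclideanSpace ℝ (Fin N) → ℝ)
    (_ : MemD s p u ∧ Integrable (fun x => w x * |u x| ^ p) volume ∧ ∫ x, w x * |u x| ^ p = 1),
    energy s p u

/-- `u` is an eigenfunction for the (finite) first eigenvalue. -/
def IsFirstEigenfunction {N : ℕ} (s p : ℝ) (w : EuclideanSpace ℝ (Fin N) → ℝ)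
    (u : EuclideanSpace ℝ (Fin N) → ℝ) : Prop :=
  firstEigenvalue s p w ≠ ∞ ∧ IsEigenfunction s p w (firstEigenvalue s p w).toReal u

end FracHardy

/-!
The argument rests on a hidden convexity of the energy. For `σ = (|u| ^ p + |v| ^ p) ^ (1 / p)`, the
reverse triangle inequality in the `ℓ^p` plane bounds `|σ x - σ y| ^ p` by
`|u x - u y| ^ p + |v x - v y| ^ p`, with equality only if `u x * v y = u y * v x`. Testing the
eigenvalue equation with `u` itself shows that a first eigenfunction minimizes
`energy u / ∫ w |u| ^ p`. If `u` and `v` are minimizers, then `σ` is a competitor, which forces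
equality for almost every `(x, y)`, so `u` and `v` are proportional. Since `|u|` is also a
minimizer, `u` is proportional to `|u|` and has constant sign.

For positivity, test the equation of `u ≥ 0` with `(η - m u)⁺`, where `η ≥ 0` is a bump function.
As `m → ∞` the right-hand side tends to `0`, while the test function converges to `η` on `{u = 0}`
and to `0` on `{u > 0}`. The limiting integrand on the left is nonpositive, and strictly negative
where `u x > 0`, `u y = 0` and `η y > 0`. By the reverse Fatou lemma it vanishes almost everywhere,
so one of the two sets is null, and it must be `{u = 0}`.
-/

namespace FracHardy

section Mollification

open scoped Convolution NNReal

variable {E F : Type*} [NormedAddCommGroup E] [NormedSpace ℝ E] [FiniteDimensional ℝ E]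
  [NormedAddCommGroup F] [NormedSpace ℝ F] {L : ℝ≥0} {f : E → F}

theorem lipschitzWith_normed_convolution [MeasurableSpace E] [BorelSpace E]
    (μ : Measure E) [IsLocallyFiniteMeasure μ] [μ.IsOpenPosMeasure] (φ : ContDiffBump (0 : E))
    (hf : LipschitzWith L f) :
    LipschitzWith L (φ.normed μ ⋆[ContinuousLinearMap.lsmul ℝ ℝ, μ] f) := by
  have integrable_smul (x : E) : Integrable (fun t => φ.normed μ t • f (x - t)) μ :=
    (φ.continuous_normed.smul (hf.continuous.comp (by fun_prop))).integrable_of_hasCompactSupport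
      φ.hasCompactSupport_normed.smul_right
  refine LipschitzWith.of_dist_le_mul fun x y => ?_
  simp only [convolution, ContinuousLinearMap.lsmul_apply, dist_eq_norm]
  rw [← integral_sub (integrable_smul x) (integrable_smul y)]
  calc ‖∫ t, φ.normed μ t • f (x - t) - φ.normed μ t • f (y - t) ∂μ‖
      ≤ ∫ t, φ.normed μ t * (L * ‖x - y‖) ∂μ := by
        refine norm_integral_le_of_norm_le (φ.integrable_normed.mul_const _)
          (ae_of_all _ fun t => ?_)
        rw [← smul_sub, norm_smul, Real.norm_of_nonneg (φ.nonneg_normed t)]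
        refine mul_le_mul_of_nonneg_left ?_ (φ.nonneg_normed t)
        simpa using hf.norm_sub_le (x - t) (y - t)
    _ = L * ‖x - y‖ := by rw [integral_mul_const, φ.integral_normed, one_mul]

theorem exists_contDiff_lipschitzWith_dist_le [CompleteSpace F] (hf : LipschitzWith L f) (n : ℕ∞)
    (x₀ : E) {ε : ℝ} (hε : 0 < ε) :
    ∃ g : E → F, ContDiff ℝ n g ∧ LipschitzWith L g ∧ g x₀ = f x₀ ∧ ∀ x, dist (g x) (f x) ≤ ε := by
  borelize E
  let μ : Measure E := Measure.addHaar
  obtain ⟨δ, hδ, hfδ⟩ := Metric.uniformContinuous_iff.1 hf.uniformContinuous (ε / 2) (half_pos hε)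
  let φ : ContDiffBump (0 : E) := ⟨δ / 2, δ, half_pos hδ, half_lt_self hδ⟩
  let g₀ : E → F := φ.normed μ ⋆[ContinuousLinearMap.lsmul ℝ ℝ, μ] f
  have dist_g₀ (x : E) : dist (g₀ x) (f x) ≤ ε / 2 :=
    ContDiffBump.dist_normed_convolution_le hf.continuous.aestronglyMeasurable
      fun y hy => (hfδ hy).le
  have lipschitz_g₀ : LipschitzWith L g₀ := lipschitzWith_normed_convolution μ φ hf
  have contDiff_g₀ : ContDiff ℝ n g₀ :=
    φ.hasCompactSupport_normed.contDiff_convolution_left _ φ.contDiff_normed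
      hf.continuous.locallyIntegrable
  refine ⟨fun x => g₀ x + (f x₀ - g₀ x₀), contDiff_g₀.add contDiff_const, ?_, by simp, fun x => ?_⟩
  · simpa using lipschitz_g₀.add (LipschitzWith.const (f x₀ - g₀ x₀))
  · calc dist (g₀ x + (f x₀ - g₀ x₀)) (f x)
        ≤ dist (g₀ x + (f x₀ - g₀ x₀)) (g₀ x) + dist (g₀ x) (f x) := dist_triangle _ _ _
      _ ≤ ε / 2 + ε / 2 := by
        refine add_le_add ?_ (dist_g₀ x)
        rw [dist_self_add_left, ← dist_eq_norm, dist_comm]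
        exact dist_g₀ x₀
      _ = ε := add_halves ε

theorem exists_contDiff_lipschitzWith_tendstoUniformly [CompleteSpace F]
    (hf : LipschitzWith L f) (k : ℕ∞) (x₀ : E) :
    ∃ g : ℕ → E → F, (∀ n, ContDiff ℝ k (g n) ∧ LipschitzWith L (g n) ∧ g n x₀ = f x₀) ∧
      TendstoUniformly g f atTop := by
  choose g hg hgL hg₀ hgf using fun n : ℕ =>
    exists_contDiff_lipschitzWith_dist_le hf k x₀ (Nat.one_div_pos_of_nat (α := ℝ) (n := n))
  refine ⟨g, fun n => ⟨hg n, hgL n, hg₀ n⟩, Metric.tendstoUniformly_iff.2 fun ε hε => ?_⟩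
  filter_upwards [tendsto_one_div_add_atTop_nhds_zero_nat.eventually_lt_const hε] with n hn x
  rw [dist_comm]
  exact (hgf n x).trans_lt hn

end Mollification

section LpConvergence

variable {α E : Type*} [MeasurableSpace α] {μ : Measure α} [NormedAddCommGroup E] {q : ℝ≥0∞}

theorem unifIntegrable_of_norm_le {ι F : Type*} [NormedAddCommGroup F] {f : ι → α → F}
    {g : ι → α → E} (hf : UnifIntegrable f q μ) (h : ∀ i x, ‖g i x‖ ≤ ‖f i x‖) :
    UnifIntegrable g q μ := by
  intro ε hε
  obtain ⟨δ, hδ, H⟩ := hf hε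
  refine ⟨δ, hδ, fun i t ht hμt => (eLpNorm_mono fun x => ?_).trans (H i t ht hμt)⟩
  simpa only [norm_indicator_eq_indicator_norm] using Set.indicator_le_indicator (h i x)

theorem unifTight_of_norm_le {ι F : Type*} [NormedAddCommGroup F] {f : ι → α → F}
    {g : ι → α → E} (hf : UnifTight f q μ) (h : ∀ i x, ‖g i x‖ ≤ ‖f i x‖) : UnifTight g q μ := by
  intro ε hε
  obtain ⟨t, ht, H⟩ := hf hε
  refine ⟨t, ht, fun i => (eLpNorm_mono fun x => ?_).trans (H i)⟩
  simpa only [norm_indicator_eq_indicator_norm] using Set.indicator_le_indicator (h i x)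

theorem tendsto_eLpNorm_sub_of_norm_le {F : Type*} [NormedAddCommGroup F] (hq : 1 ≤ q)
    (hq_top : q ≠ ∞) {f : ℕ → α → F} {f₀ : α → F} {g : ℕ → α → E} {g₀ : α → E}
    (hf : ∀ n, MemLp (f n) q μ) (hf₀ : MemLp f₀ q μ)
    (hg : ∀ n, AEStronglyMeasurable (g n) μ) (hg₀ : MemLp g₀ q μ)
    (hgf : ∀ n x, ‖g n x‖ ≤ ‖f n x‖)
    (hf_lim : Tendsto (fun n => eLpNorm (f n - f₀) q μ) atTop (𝓝 0))
    (hg_lim : ∀ᵐ x ∂μ, Tendsto (fun n => g n x) atTop (𝓝 (g₀ x))) :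
    Tendsto (fun n => eLpNorm (g n - g₀) q μ) atTop (𝓝 0) := by
  obtain ⟨-, hf_ui, hf_ut⟩ := (tendstoInMeasure_iff_tendsto_Lp hq hq_top hf hf₀).2 hf_lim
  exact tendsto_Lp_of_tendsto_ae hq hq_top hg hg₀ (unifIntegrable_of_norm_le hf_ui hgf)
    (unifTight_of_norm_le hf_ut hgf) hg_lim

theorem tendsto_eLpNorm_sub_of_norm_le_mul_max {F₁ F₂ : Type*} [NormedAddCommGroup F₁]
    [NormedSpace ℝ F₁] [NormedAddCommGroup F₂] [NormedSpace ℝ F₂] (hq : 1 ≤ q) (hq_top : q ≠ ∞)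
    {f : ℕ → α → F₁} {f₀ : α → F₁} {h : ℕ → α → F₂} {h₀ : α → F₂} {g : ℕ → α → E} {g₀ : α → E}
    {C : ℝ} (hf : ∀ n, MemLp (f n) q μ) (hf₀ : MemLp f₀ q μ) (hh : ∀ n, MemLp (h n) q μ)
    (hh₀ : MemLp h₀ q μ) (hg : ∀ n, AEStronglyMeasurable (g n) μ) (hg₀ : AEStronglyMeasurable g₀ μ)
    (hgfh : ∀ n x, ‖g n x‖ ≤ C * max ‖f n x‖ ‖h n x‖)
    (hgfh₀ : ∀ x, ‖g₀ x‖ ≤ C * max ‖f₀ x‖ ‖h₀ x‖)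
    (hf_lim : Tendsto (fun n => eLpNorm (f n - f₀) q μ) atTop (𝓝 0))
    (hh_lim : Tendsto (fun n => eLpNorm (h n - h₀) q μ) atTop (𝓝 0))
    (hg_lim : ∀ᵐ x ∂μ, Tendsto (fun n => g n x) atTop (𝓝 (g₀ x))) :
    Tendsto (fun n => eLpNorm (g n - g₀) q μ) atTop (𝓝 0) := by
  have h_pair {a : α → F₁} {b : α → F₂} (ha : MemLp a q μ) (hb : MemLp b q μ) :
      MemLp (C • fun x => (a x, b x)) q μ := (MemLp.of_fst_snd ⟨ha, hb⟩).const_smul C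
  refine tendsto_eLpNorm_sub_of_norm_le hq hq_top (fun n => h_pair (hf n) (hh n))
    (h_pair hf₀ hh₀) hg
    ((MemLp.of_fst_snd (f := fun x => (f₀ x, h₀ x)) ⟨hf₀, hh₀⟩).of_le_mul hg₀
      (ae_of_all _ hgfh₀)) (fun n x => ?_) ?_ hg_lim
  · rw [Pi.smul_apply, norm_smul, Prod.norm_def]
    exact (hgfh n x).trans (by gcongr; exact le_abs_self C)
  · have h_le (n : ℕ) : eLpNorm ((C • fun x => (f n x, h n x)) - C • fun x => (f₀ x, h₀ x)) q μ ≤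
        ‖C‖ₑ * (eLpNorm (f n - f₀) q μ + eLpNorm (h n - h₀) q μ) := by
      rw [← smul_sub, eLpNorm_const_smul]
      gcongr
      refine (eLpNorm_mono_real fun x => ?_).trans (eLpNorm_add_le
        ((hf n).sub hf₀).1.norm ((hh n).sub hh₀).1.norm hq) |>.trans_eq ?_
      · exact max_le_add_of_nonneg (norm_nonneg _) (norm_nonneg _)
      · rw [eLpNorm_norm, eLpNorm_norm]
    refine tendsto_of_tendsto_of_tendsto_of_le_of_le tendsto_const_nhds ?_ (fun _ => zero_le) h_le
    simpa using ENNReal.Tendsto.const_mul (a := ‖C‖ₑ) (hf_lim.add hh_lim) (Or.inr enorm_ne_top)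

end LpConvergence

theorem ae_eq_zero_of_tendsto_integral_zero {α : Type*} [MeasurableSpace α] {μ : Measure α}
    {f : ℕ → α → ℝ} {f₀ g : α → ℝ} (hf : ∀ n, Integrable (f n) μ) (hg : Integrable g μ)
    (hfg : ∀ n, f n ≤ᵐ[μ] g) (hf_lim : ∀ᵐ x ∂μ, Tendsto (fun n => f n x) atTop (𝓝 (f₀ x)))
    (hf₀ : f₀ ≤ᵐ[μ] 0) (hf_int : Tendsto (fun n => ∫ x, f n x ∂μ) atTop (𝓝 0)) :
    f₀ =ᵐ[μ] 0 := by
  wlog hg₀ : 0 ≤ g generalizing g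
  · exact this hg.abs (fun n => (hfg n).mono fun x hx => hx.trans (le_abs_self _))
      fun x => abs_nonneg (g x)
  have h_meas (n : ℕ) : AEMeasurable (fun x => ENNReal.ofReal (g x - f n x)) μ :=
    (hg.sub (hf n)).aemeasurable.ennreal_ofReal
  have h_meas₀ : AEMeasurable (fun x => ENNReal.ofReal (g x - f₀ x)) μ :=
    (hg.aemeasurable.sub (aemeasurable_of_tendsto_metrizable_ae atTop
      (fun n => (hf n).aemeasurable) hf_lim)).ennreal_ofReal
  have h_fatou : ∫⁻ x, ENNReal.ofReal (g x - f₀ x) ∂μ ≤ ∫⁻ x, ENNReal.ofReal (g x) ∂μ := calc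
    _ = ∫⁻ x, liminf (fun n => ENNReal.ofReal (g x - f n x)) atTop ∂μ :=
      lintegral_congr_ae (hf_lim.mono fun x hx =>
        (ENNReal.tendsto_ofReal (hx.const_sub (g x))).liminf_eq.symm)
    _ ≤ liminf (fun n => ∫⁻ x, ENNReal.ofReal (g x - f n x) ∂μ) atTop :=
      lintegral_liminf_le' h_meas
    _ = liminf (fun n => ENNReal.ofReal (∫ x, g x ∂μ - ∫ x, f n x ∂μ)) atTop := by
      congr with n
      rw [← integral_sub hg (hf n)]
      exact (ofReal_integral_eq_lintegral_ofReal (hg.sub (hf n))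
        ((hfg n).mono fun x hx => sub_nonneg.2 hx)).symm
    _ = ∫⁻ x, ENNReal.ofReal (g x) ∂μ := by
      rw [← ofReal_integral_eq_lintegral_ofReal hg (ae_of_all _ hg₀)]
      simpa using (ENNReal.tendsto_ofReal (hf_int.const_sub (∫ x, g x ∂μ))).liminf_eq
  have h_eq := ae_eq_of_ae_le_of_lintegral_le
    (hf₀.mono fun x hx => ENNReal.ofReal_le_ofReal (le_sub_self_iff _ |>.2 hx))
    hg.lintegral_lt_top.ne h_meas₀ h_fatou
  filter_upwards [h_eq, hf₀] with x hx hx₀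
  rw [ENNReal.ofReal_eq_ofReal_iff (hg₀ x) (by linarith [hg₀ x, show f₀ x ≤ 0 from hx₀])] at hx
  simpa using sub_eq_self.1 hx.symm

theorem exists_const_mul_of_ae_mul_eq_mul {α : Type*} [MeasurableSpace α] {μ : Measure α}
    [SFinite μ] {u v : α → ℝ} (hu : ¬ u =ᵐ[μ] 0) (hv : ¬ v =ᵐ[μ] 0)
    (h : ∀ᵐ z ∂μ.prod μ, u z.1 * v z.2 = u z.2 * v z.1) :
    ∃ c : ℝ, c ≠ 0 ∧ ∀ᵐ x ∂μ, u x = c * v x := by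
  obtain ⟨x, hvx, hx⟩ :=
    ((not_eventually.1 hv).and_eventually (Measure.ae_ae_of_ae_prod h)).exists
  have h_prop : ∀ᵐ y ∂μ, u y = u x / v x * v y := by
    filter_upwards [hx] with y hy
    rw [div_mul_eq_mul_div, hy, mul_div_cancel_right₀ _ hvx]
  refine ⟨u x / v x, fun h_zero => hu ?_, h_prop⟩
  filter_upwards [h_prop] with y hy
  rw [hy, h_zero, zero_mul, Pi.zero_apply]

section StrictConvexity

variable {E F : Type*} [NormedAddCommGroup E] [NormedSpace ℝ E] [NormedAddCommGroup F]
  [NormedSpace ℝ F]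

theorem strictConvexOn_univ_norm_rpow [StrictConvexSpace ℝ E] {p : ℝ} (hp : 1 < p) :
    StrictConvexOn ℝ Set.univ fun x : E => ‖x‖ ^ p := by
  have hp₀ : 0 < p := zero_lt_one.trans hp
  refine ⟨convex_univ, fun x _ y _ hxy a b ha hb hab => ?_⟩
  rcases eq_or_ne ‖x‖ ‖y‖ with h | h
  · have hlt : ‖a • x + b • y‖ < ‖y‖ := norm_combo_lt_of_ne h.le le_rfl hxy ha hb hab
    calc ‖a • x + b • y‖ ^ p < ‖y‖ ^ p := Real.rpow_lt_rpow (norm_nonneg _) hlt hp₀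
      _ = a • ‖x‖ ^ p + b • ‖y‖ ^ p := by rw [h, ← add_smul, hab, one_smul]
  · have hle : ‖a • x + b • y‖ ≤ a • ‖x‖ + b • ‖y‖ := by
      simpa [norm_smul, abs_of_pos ha, abs_of_pos hb] using norm_add_le (a • x) (b • y)
    calc ‖a • x + b • y‖ ^ p ≤ (a • ‖x‖ + b • ‖y‖) ^ p :=
          Real.rpow_le_rpow (norm_nonneg _) hle hp₀.le
      _ < a • ‖x‖ ^ p + b • ‖y‖ ^ p :=
          (strictConvexOn_rpow hp).2 (norm_nonneg x) (norm_nonneg y) h ha hb hab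

theorem strictConvexSpace_of_strictConvexOn_norm_rpow {p : ℝ}
    (h : StrictConvexOn ℝ Set.univ fun x : E => ‖x‖ ^ p) : StrictConvexSpace ℝ E := by
  refine StrictConvexSpace.of_norm_combo_ne_one fun x y hx hy hxy =>
    ⟨1 / 2, 1 / 2, by norm_num, by norm_num, by norm_num, fun hmid => ?_⟩
  have hlt := h.2 (Set.mem_univ x) (Set.mem_univ y) hxy one_half_pos one_half_pos (add_halves 1)
  norm_num [hx, hy, hmid] at hlt

theorem strictConvexSpace_withLp_prod [StrictConvexSpace ℝ E] [StrictConvexSpace ℝ F] {p : ℝ≥0∞}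
    [Fact (1 ≤ p)] (hp : 1 < p) (hp_top : p ≠ ∞) : StrictConvexSpace ℝ (WithLp p (E × F)) := by
  have hr : 1 < p.toReal := by simpa using ENNReal.toReal_strict_mono hp_top hp
  have norm_rpow (x : WithLp p (E × F)) :
      ‖x‖ ^ p.toReal = ‖x.fst‖ ^ p.toReal + ‖x.snd‖ ^ p.toReal := by
    rw [WithLp.prod_norm_eq_add (zero_lt_one.trans hr), ← Real.rpow_mul (by positivity),
      one_div_mul_cancel (zero_lt_one.trans hr).ne', Real.rpow_one]
  have hE := strictConvexOn_univ_norm_rpow (E := E) hr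
  have hF := strictConvexOn_univ_norm_rpow (E := F) hr
  refine strictConvexSpace_of_strictConvexOn_norm_rpow (p := p.toReal)
    ⟨convex_univ, fun x _ y _ hxy a b ha hb hab => ?_⟩
  simp only [norm_rpow, WithLp.add_fst, WithLp.add_snd, WithLp.smul_fst, WithLp.smul_snd,
    smul_add]
  rw [add_add_add_comm]
  by_cases hfst : x.fst = y.fst
  · have hsnd : x.snd ≠ y.snd := fun hsnd => hxy (WithLp.ofLp_injective p (Prod.ext hfst hsnd))
    exact add_lt_add_of_le_of_lt (hE.convexOn.2 trivial trivial ha.le hb.le hab)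
      (hF.2 trivial trivial hsnd ha hb hab)
  · exact add_lt_add_of_lt_of_le (hE.2 trivial trivial hfst ha hb hab)
      (hF.convexOn.2 trivial trivial ha.le hb.le hab)

end StrictConvexity

section LpPair

/-- The `ℓ^p` norm of a pair of real numbers, with a real exponent. It combines two functions into
the competitor `σ = (|u|^p + |v|^p)^(1/p)`. -/
noncomputable def lpPair (p : ℝ) (a : ℝ × ℝ) : ℝ := (|a.1| ^ p + |a.2| ^ p) ^ (1 / p)

variable {p : ℝ}

theorem lpPair_nonneg (p : ℝ) (a : ℝ × ℝ) : 0 ≤ lpPair p a := by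
  unfold lpPair
  positivity

theorem lpPair_rpow (hp : 0 < p) (a : ℝ × ℝ) : lpPair p a ^ p = |a.1| ^ p + |a.2| ^ p := by
  rw [lpPair, ← Real.rpow_mul (by positivity), one_div_mul_cancel hp.ne', Real.rpow_one]

theorem lpPair_zero (hp : 0 < p) : lpPair p 0 = 0 := by
  simp [lpPair, hp.ne']

theorem norm_toLp_eq_lpPair (hp : 0 < p) (a : ℝ × ℝ) :
    ‖WithLp.toLp (ENNReal.ofReal p) a‖ = lpPair p a := by
  rw [WithLp.prod_norm_eq_add (by simpa [hp.le] using hp), ENNReal.toReal_ofReal hp.le]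
  rfl

theorem lipschitzWith_lpPair (hp : 1 ≤ p) :
    LipschitzWith (2 ^ (1 / ENNReal.ofReal p).toReal) (lpPair p) := by
  have : Fact (1 ≤ ENNReal.ofReal p) := ⟨by simpa using hp⟩
  have h := lipschitzWith_one_norm.comp (WithLp.prod_lipschitzWith_toLp (ENNReal.ofReal p) ℝ ℝ)
  rw [one_mul] at h
  simpa only [Function.comp_def, norm_toLp_eq_lpPair (zero_lt_one.trans_le hp)] using h

theorem abs_lpPair_sub_lpPair_le (hp : 1 ≤ p) (a b : ℝ × ℝ) :
    |lpPair p a - lpPair p b| ≤ lpPair p (a - b) := by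
  have : Fact (1 ≤ ENNReal.ofReal p) := ⟨by simpa using hp⟩
  simp only [← norm_toLp_eq_lpPair (zero_lt_one.trans_le hp), WithLp.toLp_sub]
  exact abs_norm_sub_norm_le _ _

theorem mul_eq_mul_of_abs_lpPair_sub_lpPair_eq (hp : 1 < p) {a b : ℝ × ℝ}
    (h : |lpPair p a - lpPair p b| = lpPair p (a - b)) : a.1 * b.2 = b.1 * a.2 := by
  have : Fact (1 ≤ ENNReal.ofReal p) := ⟨by simpa using hp.le⟩
  have := strictConvexSpace_withLp_prod (E := ℝ) (F := ℝ) (p := ENNReal.ofReal p)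
    (by simpa using hp) ENNReal.ofReal_ne_top
  simp only [← norm_toLp_eq_lpPair (zero_lt_one.trans hp), WithLp.toLp_sub] at h
  rcases sameRay_iff_norm_sub.2 h.symm with ha | hb | ⟨r, t, hr, -, hrt⟩
  · have ha : a = 0 := by simpa using ha
    simp [ha]
  · have hb : b = 0 := by simpa using hb
    simp [hb]
  · have hrt : r • a = t • b := by simpa using congrArg WithLp.ofLp hrt
    have h₁ : r * a.1 = t * b.1 := congrArg Prod.fst hrt
    have h₂ : r * a.2 = t * b.2 := congrArg Prod.snd hrt
    refine mul_left_cancel₀ hr.ne' ?_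
    linear_combination b.2 * h₁ - b.1 * h₂

end LpPair

section FiniteEnergyKernel

variable {E : Type*} [MeasurableSpace E]

theorem lintegral_prod_fst_mul_comp_sub [AddCommGroup E] [MeasurableAdd₂ E] [MeasurableNeg E]
    (μ : Measure E) [SFinite μ] [μ.IsAddLeftInvariant] [μ.IsNegInvariant] {k K : E → ℝ≥0∞}
    (hk : Measurable k) (hK : Measurable K) :
    ∫⁻ z, k z.1 * K (z.1 - z.2) ∂μ.prod μ = (∫⁻ x, k x ∂μ) * ∫⁻ h, K h ∂μ := by
  have h_inner (x : E) : ∫⁻ y, k x * K (x - y) ∂μ = k x * ∫⁻ h, K h ∂μ := by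
    rw [lintegral_const_mul _ (by fun_prop), lintegral_sub_left_eq_self]
  rw [lintegral_prod _ (by fun_prop)]
  simp only [h_inner, lintegral_mul_const _ hk]

theorem lintegral_prod_snd_mul_comp_sub [AddCommGroup E] [MeasurableAdd₂ E] [MeasurableNeg E]
    (μ : Measure E) [SFinite μ] [μ.IsAddRightInvariant] {k K : E → ℝ≥0∞}
    (hk : Measurable k) (hK : Measurable K) :
    ∫⁻ z, k z.2 * K (z.1 - z.2) ∂μ.prod μ = (∫⁻ x, k x ∂μ) * ∫⁻ h, K h ∂μ := by
  have h_inner (y : E) : ∫⁻ x, k y * K (x - y) ∂μ = k y * ∫⁻ h, K h ∂μ := by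
    rw [lintegral_const_mul _ (by fun_prop), lintegral_sub_right_eq_self]
  rw [lintegral_prod_symm _ (by fun_prop)]
  simp only [h_inner, lintegral_mul_const _ hk]

variable [NormedAddCommGroup E] [NormedSpace ℝ E] [FiniteDimensional ℝ E] [BorelSpace E]

theorem integrableOn_ball_min_rpow_div_norm_rpow (μ : Measure E) [μ.IsAddHaarMeasure]
    {L M p t : ℝ} (hL : 0 ≤ L) (hM : 0 ≤ M) (hp : 0 < p) (htp : t < p) :
    IntegrableOn (fun h => min M (L * ‖h‖) ^ p / ‖h‖ ^ (Module.finrank ℝ E + t))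
      (Metric.ball 0 1) μ := by
  set d : ℕ := Module.finrank ℝ E
  rcases Nat.eq_zero_or_pos d with hd | hd
  · have : Subsingleton E := Module.finrank_zero_iff.1 hd
    simp [hp.ne', hM, Subsingleton.eq_zero]
  refine integrableOn_ball_of_norm_le_rpow (C := L ^ p) (α := d + t - p) hd (by linarith)
    (ae_of_all _ fun h => ?_) (Measurable.aestronglyMeasurable (by fun_prop))
  rw [Real.norm_of_nonneg (by positivity)]
  calc min M (L * ‖h‖) ^ p / ‖h‖ ^ (d + t) ≤ (L * ‖h‖) ^ p / ‖h‖ ^ (d + t) := by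
        gcongr
        exact min_le_right _ _
    _ ≤ L ^ p * ‖h‖ ^ (-(d + t - p)) := by
        rcases (norm_nonneg h).eq_or_lt' with h0 | h0
        · simp only [h0, mul_zero, Real.zero_rpow hp.ne', zero_div]
          positivity
        · rw [Real.mul_rpow hL h0.le, mul_div_assoc, ← Real.rpow_sub h0, neg_sub]

theorem integrableOn_compl_ball_min_rpow_div_norm_rpow (μ : Measure E) [μ.IsAddHaarMeasure]
    {L M p t : ℝ} (hL : 0 ≤ L) (hM : 0 ≤ M) (hp : 0 ≤ p) (ht : 0 < t) :
    IntegrableOn (fun h => min M (L * ‖h‖) ^ p / ‖h‖ ^ (Module.finrank ℝ E + t))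
      (Metric.ball 0 1)ᶜ μ := by
  set d : ℕ := Module.finrank ℝ E
  have h_int := (integrable_one_add_norm (μ := μ) (lt_add_of_pos_right (d : ℝ) ht)).const_mul
    (M ^ p * 2 ^ (d + t))
  refine h_int.integrableOn.mono' (Measurable.aestronglyMeasurable (by fun_prop))
    ((ae_restrict_iff' measurableSet_ball.compl).2 (ae_of_all _ fun h hh => ?_))
  have hh : 1 ≤ ‖h‖ := by simpa using hh
  rw [Real.norm_of_nonneg (by positivity)]
  calc min M (L * ‖h‖) ^ p / ‖h‖ ^ (d + t) ≤ M ^ p / ((1 + ‖h‖) / 2) ^ (d + t) := by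
        gcongr ?_ ^ _ / ?_ ^ _
        · exact min_le_left _ _
        · linarith
    _ = M ^ p * 2 ^ (d + t) * (1 + ‖h‖) ^ (-(d + t)) := by
        rw [Real.div_rpow (by positivity) zero_le_two, Real.rpow_neg (by positivity)]
        field_simp

theorem integrable_min_rpow_div_norm_rpow (μ : Measure E) [μ.IsAddHaarMeasure] {L M p t : ℝ}
    (hL : 0 ≤ L) (hM : 0 ≤ M) (ht : 0 < t) (htp : t < p) :
    Integrable (fun h => min M (L * ‖h‖) ^ p / ‖h‖ ^ (Module.finrank ℝ E + t)) μ := by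
  rw [← integrableOn_univ, ← Set.union_compl_self (Metric.ball (0 : E) 1)]
  exact (integrableOn_ball_min_rpow_div_norm_rpow μ hL hM (ht.trans htp) htp).union
    (integrableOn_compl_ball_min_rpow_div_norm_rpow μ hL hM (ht.trans htp).le ht)

end FiniteEnergyKernel

section Energy

variable {N : ℕ} {s p : ℝ}

local notation "ℝᴺ" => EuclideanSpace ℝ (Fin N)

theorem energy_lt_top_of_lipschitzWith (hs0 : 0 < s) (hs1 : s < 1) (hp : 0 < p) {φ : ℝᴺ → ℝ}
    {L : NNReal} (hL : LipschitzWith L φ) (hφ : HasCompactSupport φ) : energy s p φ < ∞ := by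
  obtain ⟨M, hM⟩ := hφ.exists_bound_of_continuous hL.continuous
  have hM₀ : 0 ≤ M := (norm_nonneg _).trans (hM 0)
  let k : ℝᴺ → ℝ≥0∞ := (tsupport φ).indicator 1
  let K : ℝᴺ → ℝ≥0∞ := fun h =>
    ENNReal.ofReal (min (2 * M) (L * ‖h‖) ^ p / ‖h‖ ^ ((N : ℝ) + s * p))
  have hk_meas : Measurable k := measurable_one.indicator (isClosed_tsupport φ).measurableSet
  have hK_meas : Measurable K := by fun_prop
  have hk : ∫⁻ x, k x ≠ ∞ := by
    simpa [k, (isClosed_tsupport φ).measurableSet] using hφ.measure_lt_top.ne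
  have hK : ∫⁻ h, K h ≠ ∞ := by
    have h_int := integrable_min_rpow_div_norm_rpow (volume : Measure ℝᴺ) (L := L) (M := 2 * M)
      L.2 (by positivity) (mul_pos hs0 hp) (mul_lt_of_lt_one_left hp hs1)
    rw [finrank_euclideanSpace_fin] at h_int
    exact h_int.lintegral_lt_top.ne
  have abs_sub_le (x y : ℝᴺ) : |φ x - φ y| ≤ min (2 * M) (L * ‖x - y‖) := by
    refine le_min ?_ (hL.norm_sub_le x y)
    calc |φ x - φ y| ≤ |φ x| + |φ y| := abs_sub _ _
      _ ≤ 2 * M := by linarith [hM x, hM y, Real.norm_eq_abs (φ x), Real.norm_eq_abs (φ y)]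
  have integrand_le (z : ℝᴺ × ℝᴺ) :
      ENNReal.ofReal (|φ z.1 - φ z.2| ^ p / ‖z.1 - z.2‖ ^ ((N : ℝ) + s * p)) ≤
        k z.1 * K (z.1 - z.2) + k z.2 * K (z.1 - z.2) := by
    have hle : ENNReal.ofReal (|φ z.1 - φ z.2| ^ p / ‖z.1 - z.2‖ ^ ((N : ℝ) + s * p)) ≤
        K (z.1 - z.2) := by
      refine ENNReal.ofReal_le_ofReal ?_
      gcongr
      exact abs_sub_le _ _
    by_cases h₁ : z.1 ∈ tsupport φ
    · exact le_add_right (by simpa [k, h₁] using hle)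
    by_cases h₂ : z.2 ∈ tsupport φ
    · exact le_add_left (by simpa [k, h₂] using hle)
    simp [image_eq_zero_of_notMem_tsupport, h₁, h₂, hp.ne']
  refine (lintegral_mono integrand_le).trans_lt ?_
  rw [lintegral_add_left (by fun_prop), Measure.volume_eq_prod,
    lintegral_prod_fst_mul_comp_sub _ hk_meas hK_meas,
    lintegral_prod_snd_mul_comp_sub _ hk_meas hK_meas]
  exact (ENNReal.add_ne_top.2 ⟨ENNReal.mul_ne_top hk hK, ENNReal.mul_ne_top hk hK⟩).lt_top

/-- The fractional difference quotient `(u(x) - u(y)) / |x - y|^(N/p + s)`. The energy is the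
`p`-th power of its `L^p` norm, which turns convergence in energy into convergence in `L^p`. -/
noncomputable def gagliardoQuotient (s p : ℝ) (u : ℝᴺ → ℝ) (z : ℝᴺ × ℝᴺ) : ℝ :=
  (u z.1 - u z.2) / ‖z.1 - z.2‖ ^ (((N : ℝ) + s * p) / p)

theorem gagliardoQuotient_sub (u v : ℝᴺ → ℝ) :
    gagliardoQuotient s p (u - v) = gagliardoQuotient s p u - gagliardoQuotient s p v := by
  ext z
  simp only [gagliardoQuotient, Pi.sub_apply]
  ring

theorem aestronglyMeasurable_gagliardoQuotient {u : ℝᴺ → ℝ} (hu : AEStronglyMeasurable u volume) :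
    AEStronglyMeasurable (gagliardoQuotient s p u) volume := by
  rw [Measure.volume_eq_prod]
  have h_weight : AEMeasurable (fun z : ℝᴺ × ℝᴺ => ‖z.1 - z.2‖ ^ (((N : ℝ) + s * p) / p))
      (volume.prod volume) := by
    fun_prop
  exact ((hu.comp_fst.sub hu.comp_snd).aemeasurable.div h_weight).aestronglyMeasurable

theorem eLpNorm_gagliardoQuotient (hp : 0 < p) (u : ℝᴺ → ℝ) :
    eLpNorm (gagliardoQuotient s p u) (ENNReal.ofReal p) volume = energy s p u ^ (1 / p) := by
  rw [eLpNorm_eq_lintegral_rpow_enorm_toReal (by simpa using hp) ENNReal.ofReal_ne_top,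
    ENNReal.toReal_ofReal hp.le]
  congr 1
  refine lintegral_congr fun z => ?_
  rw [← ofReal_norm, ENNReal.ofReal_rpow_of_nonneg (norm_nonneg _) hp.le, Real.norm_eq_abs,
    gagliardoQuotient, abs_div, Real.div_rpow (abs_nonneg _) (abs_nonneg _),
    abs_of_nonneg (Real.rpow_nonneg (norm_nonneg _) _), ← Real.rpow_mul (norm_nonneg _),
    div_mul_cancel₀ _ hp.ne']

theorem memLp_gagliardoQuotient_iff (hp : 0 < p) {u : ℝᴺ → ℝ}
    (hu : AEStronglyMeasurable u volume) :
    MemLp (gagliardoQuotient s p u) (ENNReal.ofReal p) volume ↔ energy s p u < ∞ := by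
  rw [MemLp, eLpNorm_gagliardoQuotient hp, ENNReal.rpow_lt_top_iff_of_pos (by positivity)]
  exact and_iff_right (aestronglyMeasurable_gagliardoQuotient hu)

theorem tendsto_energy_zero_iff (hp : 0 < p) {u : ℕ → ℝᴺ → ℝ} :
    Tendsto (fun n => energy s p (u n)) atTop (𝓝 0) ↔
      Tendsto (fun n => eLpNorm (gagliardoQuotient s p (u n)) (ENNReal.ofReal p) volume) atTop
        (𝓝 0) := by
  simp only [eLpNorm_gagliardoQuotient hp]
  refine ⟨fun h => ?_, fun h => ?_⟩
  · simpa [hp] using h.ennrpow_const (1 / p)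
  · simpa [hp, ← ENNReal.rpow_mul, hp.ne'] using h.ennrpow_const p

theorem one_le_critExp (hs0 : 0 < s) (hp : 1 ≤ p) (hsp : s * p < N) : 1 ≤ critExp N s p := by
  rw [critExp, ENNReal.one_le_ofReal, one_le_div (by linarith)]
  nlinarith

theorem memD_of_contDiff (hp : 0 < p) {φ : ℝᴺ → ℝ} (hφ : ContDiff ℝ 1 φ)
    (hφc : HasCompactSupport φ) : MemD s p φ :=
  ⟨hφ.continuous.aestronglyMeasurable, fun _ => φ, fun _ => ⟨hφ, hφc⟩,
    by simp [energy, hp.ne'], by simp⟩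

theorem energy_const_mul (c : ℝ) (u : ℝᴺ → ℝ) :
    energy s p (fun x => c * u x) = ENNReal.ofReal (|c| ^ p) * energy s p u := by
  rw [energy, energy, ← lintegral_const_mul' _ _ ENNReal.ofReal_ne_top]
  refine lintegral_congr fun z => ?_
  rw [← ENNReal.ofReal_mul (by positivity), ← mul_sub, abs_mul,
    Real.mul_rpow (abs_nonneg _) (abs_nonneg _), mul_div_assoc]

theorem MemD.const_mul {u : ℝᴺ → ℝ} (hu : MemD s p u) (c : ℝ) :
    MemD s p (fun x => c * u x) := by
  obtain ⟨hum, φ, hφ, hφE, hφL⟩ := hu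
  have h_diff (n : ℕ) : (fun x => c * φ n x) - (fun x => c * u x) = c • (φ n - u) := by
    ext x
    simp only [Pi.sub_apply, Pi.smul_apply, smul_eq_mul, mul_sub]
  refine ⟨hum.const_mul c, fun n x => c * φ n x,
    fun n => ⟨contDiff_const.mul (hφ n).1, (hφ n).2.mul_left⟩, ?_, ?_⟩ <;> simp only [h_diff]
  · have := ENNReal.Tendsto.const_mul (a := ENNReal.ofReal (|c| ^ p)) hφE
      (Or.inr ENNReal.ofReal_ne_top)
    rw [mul_zero] at this
    exact this.congr fun n => (energy_const_mul c (φ n - u)).symm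
  · simp only [eLpNorm_const_smul]
    simpa using ENNReal.Tendsto.const_mul (a := ‖c‖ₑ) hφL (Or.inr enorm_ne_top)

theorem MemD.energy_lt_top (hs0 : 0 < s) (hs1 : s < 1) (hp : 1 ≤ p) {u : ℝᴺ → ℝ}
    (hu : MemD s p u) : energy s p u < ∞ := by
  have hp₀ : 0 < p := zero_lt_one.trans_le hp
  obtain ⟨hum, φ, hφ, hφE, -⟩ := hu
  obtain ⟨n, hn⟩ := (hφE.eventually_lt_const ENNReal.coe_lt_top).exists
  obtain ⟨L, hL⟩ := (hφ n).1.lipschitzWith_of_hasCompactSupport (hφ n).2 one_ne_zero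
  have hφm := (hφ n).1.continuous.aestronglyMeasurable (μ := volume)
  have h_approx := (memLp_gagliardoQuotient_iff hp₀ hφm).2
    (energy_lt_top_of_lipschitzWith hs0 hs1 hp₀ hL (hφ n).2)
  have h_diff := (memLp_gagliardoQuotient_iff hp₀ (hφm.sub hum)).2 hn
  rw [gagliardoQuotient_sub] at h_diff
  rw [← memLp_gagliardoQuotient_iff hp₀ hum]
  simpa using h_approx.sub h_diff

theorem MemD.memLp_gagliardoQuotient (hs0 : 0 < s) (hs1 : s < 1) (hp : 1 ≤ p) {u : ℝᴺ → ℝ}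
    (hu : MemD s p u) : MemLp (gagliardoQuotient s p u) (ENNReal.ofReal p) volume :=
  (memLp_gagliardoQuotient_iff (zero_lt_one.trans_le hp) hu.1).2 (hu.energy_lt_top hs0 hs1 hp)

theorem MemD.memLp_critExp {u : ℝᴺ → ℝ} (hu : MemD s p u) : MemLp u (critExp N s p) volume := by
  obtain ⟨hum, φ, hφ, -, hφL⟩ := hu
  obtain ⟨n, hn⟩ := (hφL.eventually_lt_const ENNReal.coe_lt_top).exists
  have h_approx : MemLp (φ n) (critExp N s p) volume :=
    (hφ n).1.continuous.memLp_of_hasCompactSupport (hφ n).2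
  simpa using h_approx.sub ⟨h_approx.1.sub hum, hn⟩

theorem MemD.exists_contDiff_approx_ae (hcrit : critExp N s p ≠ 0) {u : ℝᴺ → ℝ} (hu : MemD s p u) :
    ∃ φ : ℕ → ℝᴺ → ℝ, (∀ n, ContDiff ℝ 1 (φ n) ∧ HasCompactSupport (φ n)) ∧
      Tendsto (fun n => energy s p (φ n - u)) atTop (𝓝 0) ∧
      Tendsto (fun n => eLpNorm (φ n - u) (critExp N s p) volume) atTop (𝓝 0) ∧
      ∀ᵐ x ∂volume, Tendsto (fun n => φ n x) atTop (𝓝 (u x)) := by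
  obtain ⟨hum, φ, hφ, hφE, hφL⟩ := hu
  have hφm (n : ℕ) := (hφ n).1.continuous.aestronglyMeasurable (μ := volume)
  obtain ⟨k, hk, h_ae⟩ :=
    (tendstoInMeasure_of_tendsto_eLpNorm hcrit hφm hum hφL).exists_seq_tendsto_ae
  exact ⟨fun n => φ (k n), fun n => hφ (k n), hφE.comp hk.tendsto_atTop,
    hφL.comp hk.tendsto_atTop, h_ae⟩

theorem abs_gagliardoQuotient_comp_le {T : ℝ × ℝ → ℝ} {L : NNReal} (hT : LipschitzWith L T)
    (u v : ℝᴺ → ℝ) (z : ℝᴺ × ℝᴺ) :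
    |gagliardoQuotient s p (fun x => T (u x, v x)) z| ≤
      L * max |gagliardoQuotient s p u z| |gagliardoQuotient s p v z| := by
  have h_weight : 0 ≤ ‖z.1 - z.2‖ ^ (((N : ℝ) + s * p) / p) := by positivity
  simp only [gagliardoQuotient, abs_div, abs_of_nonneg h_weight]
  rw [max_div_div_right h_weight, mul_div_assoc']
  gcongr
  exact hT.dist_le_mul (u z.1, v z.1) (u z.2, v z.2)

theorem ae_tendsto_gagliardoQuotient {φ : ℕ → ℝᴺ → ℝ} {u : ℝᴺ → ℝ}
    (h : ∀ᵐ x ∂volume, Tendsto (fun n => φ n x) atTop (𝓝 (u x))) :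
    ∀ᵐ z ∂volume, Tendsto (fun n => gagliardoQuotient s p (φ n) z) atTop
      (𝓝 (gagliardoQuotient s p u z)) := by
  rw [Measure.volume_eq_prod]
  filter_upwards [Measure.quasiMeasurePreserving_fst.ae h,
    Measure.quasiMeasurePreserving_snd.ae h] with z hz₁ hz₂
  exact (hz₁.sub hz₂).div_const _

theorem MemD.comp_lipschitzWith₂ (hs0 : 0 < s) (hs1 : s < 1) (hp : 1 ≤ p) (hsp : s * p < N)
    {u v : ℝᴺ → ℝ} (hu : MemD s p u) (hv : MemD s p v) {T : ℝ × ℝ → ℝ} {L : NNReal}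
    (hT : LipschitzWith L T) (hT₀ : T 0 = 0) : MemD s p (fun x => T (u x, v x)) := by
  have hp₀ : 0 < p := zero_lt_one.trans_le hp
  have hcrit := one_le_critExp hs0 hp hsp
  have hcrit₀ : critExp N s p ≠ 0 := (zero_lt_one.trans_le hcrit).ne'
  obtain ⟨φ, hφ, hφE, hφL, hφ_ae⟩ := hu.exists_contDiff_approx_ae hcrit₀
  obtain ⟨ψ, hψ, hψE, hψL, hψ_ae⟩ := hv.exists_contDiff_approx_ae hcrit₀
  obtain ⟨S, hS, hST⟩ := exists_contDiff_lipschitzWith_tendstoUniformly hT 1 0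
  let χ (n : ℕ) (x : ℝᴺ) : ℝ := S n (φ n x, ψ n x)
  have hχ (n : ℕ) : ContDiff ℝ 1 (χ n) ∧ HasCompactSupport (χ n) :=
    ⟨(hS n).1.comp ((hφ n).1.prodMk (hψ n).1),
      (hφ n).2.comp₂_left (m := fun a b => S n (a, b)) (hψ n).2 ((hS n).2.2.trans hT₀)⟩
  have hχ_ae : ∀ᵐ x ∂volume, Tendsto (fun n => χ n x) atTop (𝓝 (T (u x, v x))) := by
    filter_upwards [hφ_ae, hψ_ae] with x hx₁ hx₂
    exact hST.tendsto_comp hT.continuous.continuousAt (hx₁.prodMk_nhds hx₂)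
  have h_meas : AEStronglyMeasurable (fun x => T (u x, v x)) volume :=
    hT.continuous.comp_aestronglyMeasurable (hu.1.prodMk hv.1)
  have h_memD {f : ℝᴺ → ℝ} (hf : ContDiff ℝ 1 f ∧ HasCompactSupport f) : MemD s p f :=
    memD_of_contDiff hp₀ hf.1 hf.2
  have h_quot {f : ℝᴺ → ℝ} (hf : MemD s p f) := hf.memLp_gagliardoQuotient hs0 hs1 hp
  have h_norm_le {R : ℝ × ℝ → ℝ} (hR : LipschitzWith L R) (hR₀ : R 0 = 0) (a : ℝ × ℝ) :
      ‖R a‖ ≤ L * ‖a‖ := by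
    simpa [hR₀] using hR.dist_le_mul a 0
  refine ⟨h_meas, χ, hχ, ?_, ?_⟩
  · simp only [tendsto_energy_zero_iff hp₀, gagliardoQuotient_sub] at hφE hψE ⊢
    exact tendsto_eLpNorm_sub_of_norm_le_mul_max (by simpa using hp) ENNReal.ofReal_ne_top
      (fun n => h_quot (h_memD (hφ n))) (h_quot hu) (fun n => h_quot (h_memD (hψ n))) (h_quot hv)
      (fun n => (h_quot (h_memD (hχ n))).1) (aestronglyMeasurable_gagliardoQuotient h_meas)
      (fun n => abs_gagliardoQuotient_comp_le (hS n).2.1 (φ n) (ψ n))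
      (abs_gagliardoQuotient_comp_le hT u v) hφE hψE (ae_tendsto_gagliardoQuotient hχ_ae)
  · exact tendsto_eLpNorm_sub_of_norm_le_mul_max hcrit ENNReal.ofReal_ne_top
      (fun n => (h_memD (hφ n)).memLp_critExp) hu.memLp_critExp
      (fun n => (h_memD (hψ n)).memLp_critExp) hv.memLp_critExp (fun n => (h_memD (hχ n)).1)
      h_meas (fun n x => h_norm_le (hS n).2.1 ((hS n).2.2.trans hT₀) _)
      (fun x => h_norm_le hT hT₀ _) hφL hψL hχ_ae

theorem MemD.abs (hs0 : 0 < s) (hs1 : s < 1) (hp : 1 ≤ p) (hsp : s * p < N) {u : ℝᴺ → ℝ}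
    (hu : MemD s p u) : MemD s p (fun x => |u x|) :=
  hu.comp_lipschitzWith₂ hs0 hs1 hp hsp hu (lipschitzWith_one_norm.comp LipschitzWith.prod_fst)
    (by simp)

theorem abs_rpow_sub_two_mul_abs (hp : 1 < p) (a : ℝ) : |a| ^ (p - 2) * |a| = |a| ^ (p - 1) := by
  rw [← Real.rpow_add_one' (abs_nonneg a) (by linarith)]
  ring_nf

theorem abs_rpow_sub_two_mul_mul_self (hp : 1 < p) (a : ℝ) : |a| ^ (p - 2) * a * a = |a| ^ p := by
  rw [mul_assoc, ← abs_mul_abs_self a, ← mul_assoc, abs_rpow_sub_two_mul_abs hp,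
    ← Real.rpow_add_one' (abs_nonneg a) (by linarith), sub_add_cancel]

theorem abs_rpow_sub_one_mul_abs_le (hp : 1 < p) (a b : ℝ) :
    |a| ^ (p - 1) * |b| ≤ |a| ^ p + |b| ^ p := by
  have h_max : 0 ≤ max |a| |b| := (abs_nonneg a).trans (le_max_left _ _)
  calc |a| ^ (p - 1) * |b| ≤ max |a| |b| ^ (p - 1) * max |a| |b| := by
        gcongr
        exacts [le_max_left _ _, le_max_right _ _]
    _ = max |a| |b| ^ p := by
        rw [← Real.rpow_add_one' h_max (by linarith), sub_add_cancel]
    _ ≤ |a| ^ p + |b| ^ p := by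
        rcases max_choice |a| |b| with h | h <;> rw [h]
        · exact le_add_of_nonneg_right (by positivity)
        · exact le_add_of_nonneg_left (by positivity)

/-- The integrand of the weak formulation of the fractional `p`-Laplacian, so that
`⟨(-Δ_p)^s u, v⟩ = ∫ formDensity s p u v`. -/
noncomputable def formDensity (s p : ℝ) (u v : ℝᴺ → ℝ) (z : ℝᴺ × ℝᴺ) : ℝ :=
  |u z.1 - u z.2| ^ (p - 2) * (u z.1 - u z.2) * (v z.1 - v z.2) / ‖z.1 - z.2‖ ^ ((N : ℝ) + s * p)

theorem formDensity_self (hp : 1 < p) (u : ℝᴺ → ℝ) (z : ℝᴺ × ℝᴺ) :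
    formDensity s p u u z = |u z.1 - u z.2| ^ p / ‖z.1 - z.2‖ ^ ((N : ℝ) + s * p) := by
  rw [formDensity, abs_rpow_sub_two_mul_mul_self hp]

theorem formDensity_self_nonneg (hp : 1 < p) (u : ℝᴺ → ℝ) (z : ℝᴺ × ℝᴺ) :
    0 ≤ formDensity s p u u z := by
  rw [formDensity_self hp]
  positivity

theorem formDensity_eq_zero_iff {u v : ℝᴺ → ℝ} {z : ℝᴺ × ℝᴺ} :
    formDensity s p u v z = 0 ↔ u z.1 = u z.2 ∨ v z.1 = v z.2 := by
  refine ⟨fun h => ?_, fun h => by rcases h with h | h <;> simp [formDensity, h]⟩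
  by_contra! hne
  have h_ne : z.1 ≠ z.2 := fun h => hne.1 (by rw [h])
  have h_weight := Real.rpow_pos_of_pos (norm_pos_iff.2 (sub_ne_zero.2 h_ne)) ((N : ℝ) + s * p)
  have h_rpow := Real.rpow_pos_of_pos (abs_pos.2 (sub_ne_zero.2 hne.1)) (p - 2)
  simp [formDensity, h_weight.ne', h_rpow.ne', sub_ne_zero.2 hne.1, sub_ne_zero.2 hne.2] at h

theorem energy_eq_lintegral_formDensity (hp : 1 < p) (u : ℝᴺ → ℝ) :
    energy s p u = ∫⁻ z, ENNReal.ofReal (formDensity s p u u z) := by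
  simp only [energy, formDensity_self hp]

theorem aestronglyMeasurable_formDensity {u v : ℝᴺ → ℝ} (hu : AEStronglyMeasurable u volume)
    (hv : AEStronglyMeasurable v volume) : AEStronglyMeasurable (formDensity s p u v) volume := by
  rw [Measure.volume_eq_prod]
  have h_weight : AEMeasurable (fun z : ℝᴺ × ℝᴺ => ‖z.1 - z.2‖ ^ ((N : ℝ) + s * p))
      (volume.prod volume) := by
    fun_prop
  have h_diff {f : ℝᴺ → ℝ} (hf : AEStronglyMeasurable f volume) :
      AEMeasurable (fun z : ℝᴺ × ℝᴺ => f z.1 - f z.2) (volume.prod volume) :=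
    (hf.comp_fst.sub hf.comp_snd).aemeasurable
  exact (((((h_diff hu).norm.pow_const (p - 2)).mul (h_diff hu)).mul (h_diff hv)).div
    h_weight).aestronglyMeasurable

theorem abs_formDensity (u v : ℝᴺ → ℝ) (z : ℝᴺ × ℝᴺ) :
    |formDensity s p u v z| = |u z.1 - u z.2| ^ (p - 2) * |u z.1 - u z.2| * |v z.1 - v z.2| /
      ‖z.1 - z.2‖ ^ ((N : ℝ) + s * p) := by
  have h_weight : 0 ≤ ‖z.1 - z.2‖ ^ ((N : ℝ) + s * p) := by positivity
  have h_rpow : 0 ≤ |u z.1 - u z.2| ^ (p - 2) := by positivity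
  rw [formDensity, abs_div, abs_mul, abs_mul, abs_of_nonneg h_weight, abs_of_nonneg h_rpow]

theorem abs_formDensity_le (hp : 1 < p) (u v : ℝᴺ → ℝ) (z : ℝᴺ × ℝᴺ) :
    |formDensity s p u v z| ≤ formDensity s p u u z + formDensity s p v v z := by
  rw [abs_formDensity, abs_rpow_sub_two_mul_abs hp, formDensity_self hp, formDensity_self hp,
    ← add_div]
  gcongr
  exact abs_rpow_sub_one_mul_abs_le hp _ _

theorem integrable_formDensity_self (hp : 1 < p) {u : ℝᴺ → ℝ} (hu : AEStronglyMeasurable u volume)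
    (hE : energy s p u < ∞) : Integrable (formDensity s p u u) volume := by
  refine ⟨aestronglyMeasurable_formDensity hu hu, ?_⟩
  rw [hasFiniteIntegral_iff_ofReal (ae_of_all _ (formDensity_self_nonneg hp u))]
  rwa [← energy_eq_lintegral_formDensity hp]

theorem integrable_formDensity (hp : 1 < p) {u v : ℝᴺ → ℝ} (hu : AEStronglyMeasurable u volume)
    (hv : AEStronglyMeasurable v volume) (hEu : energy s p u < ∞) (hEv : energy s p v < ∞) :
    Integrable (formDensity s p u v) volume :=
  ((integrable_formDensity_self hp hu hEu).add (integrable_formDensity_self hp hv hEv)).mono'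
    (aestronglyMeasurable_formDensity hu hv) (ae_of_all _ (abs_formDensity_le hp u v))

theorem ofReal_integral_formDensity_self (hp : 1 < p) {u : ℝᴺ → ℝ}
    (hu : AEStronglyMeasurable u volume) (hE : energy s p u < ∞) :
    ENNReal.ofReal (∫ z, formDensity s p u u z) = energy s p u := by
  rw [ofReal_integral_eq_lintegral_ofReal (integrable_formDensity_self hp hu hE)
    (ae_of_all _ (formDensity_self_nonneg hp u)), energy_eq_lintegral_formDensity hp]

theorem MemD.ae_eq_zero_of_energy_eq_zero (hs0 : 0 < s) (hp : 1 < p) (hsp : s * p < N)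
    {u : ℝᴺ → ℝ} (hu : MemD s p u) (hE : energy s p u = 0) : u =ᵐ[volume] 0 := by
  have hcrit : critExp N s p ≠ 0 := (zero_lt_one.trans_le (one_le_critExp hs0 hp.le hsp)).ne'
  have hN : 0 < N := by
    have : (0 : ℝ) < N := (mul_pos hs0 (zero_lt_one.trans hp)).trans hsp
    exact_mod_cast this
  have : Nonempty (Fin N) := ⟨⟨0, hN⟩⟩
  have h_zero : ∀ᵐ z : ℝᴺ × ℝᴺ, u z.1 = u z.2 := by
    rw [energy_eq_lintegral_formDensity hp, lintegral_eq_zero_iff'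
      (aestronglyMeasurable_formDensity hu.1 hu.1).aemeasurable.ennreal_ofReal] at hE
    filter_upwards [hE] with z hz
    simpa using formDensity_eq_zero_iff.1
      ((ENNReal.ofReal_eq_zero.1 hz).antisymm (formDensity_self_nonneg hp u z))
  rw [Measure.volume_eq_prod] at h_zero
  obtain ⟨x, hx⟩ := (Measure.ae_ae_of_ae_prod h_zero).exists
  have hux : u =ᵐ[volume] fun _ => u x := hx.mono fun y hy => hy.symm
  have h_const : MemLp (fun _ : ℝᴺ => u x) (critExp N s p) volume := hu.memLp_critExp.ae_eq hux
  have h_infinite : volume (Set.univ : Set ℝᴺ) = ∞ := measure_univ_of_isAddLeftInvariant _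
  rcases (memLp_const_iff hcrit ENNReal.ofReal_ne_top).1 h_const with h | h
  · exact hux.trans (by rw [h]; rfl)
  · exact absurd h_infinite h.ne

theorem ae_mul_eq_mul_of_energy_add_le (hp : 1 < p) {u v : ℝᴺ → ℝ}
    (hu : AEStronglyMeasurable u volume) (hv : AEStronglyMeasurable v volume)
    (hE_top : energy s p (fun x => lpPair p (u x, v x)) ≠ ∞)
    (hE : energy s p u + energy s p v ≤ energy s p (fun x => lpPair p (u x, v x))) :
    ∀ᵐ z : ℝᴺ × ℝᴺ, u z.1 * v z.2 = u z.2 * v z.1 := by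
  have hp₀ : 0 < p := zero_lt_one.trans hp
  let σ : ℝᴺ → ℝ := fun x => lpPair p (u x, v x)
  have h_meas {f : ℝᴺ → ℝ} (hf : AEStronglyMeasurable f volume) :
      AEMeasurable (fun z => ENNReal.ofReal (formDensity s p f f z)) volume :=
    (aestronglyMeasurable_formDensity hf hf).aemeasurable.ennreal_ofReal
  have h_add (z : ℝᴺ × ℝᴺ) :
      ENNReal.ofReal (formDensity s p u u z) + ENNReal.ofReal (formDensity s p v v z) =
        ENNReal.ofReal (lpPair p ((u z.1, v z.1) - (u z.2, v z.2)) ^ p /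
          ‖z.1 - z.2‖ ^ ((N : ℝ) + s * p)) := by
    rw [← ENNReal.ofReal_add (formDensity_self_nonneg hp u z) (formDensity_self_nonneg hp v z),
      formDensity_self hp, formDensity_self hp, ← add_div, lpPair_rpow hp₀]
    rfl
  have h_eq : (fun z => ENNReal.ofReal (formDensity s p σ σ z)) =ᵐ[volume] fun z =>
      ENNReal.ofReal (formDensity s p u u z) + ENNReal.ofReal (formDensity s p v v z) := by
    refine ae_eq_of_ae_le_of_lintegral_le (ae_of_all _ fun z => ?_)
      (by rwa [← energy_eq_lintegral_formDensity hp]) ((h_meas hu).add (h_meas hv)) ?_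
    · dsimp only
      rw [h_add, formDensity_self hp]
      gcongr
      exact abs_lpPair_sub_lpPair_le hp.le _ _
    · rwa [lintegral_add_left' (h_meas hu), ← energy_eq_lintegral_formDensity hp,
        ← energy_eq_lintegral_formDensity hp, ← energy_eq_lintegral_formDensity hp]
  filter_upwards [h_eq] with z hz
  rcases eq_or_ne z.1 z.2 with h_diag | h_diag
  · rw [h_diag]
  have h_weight : 0 < ‖z.1 - z.2‖ ^ ((N : ℝ) + s * p) :=
    Real.rpow_pos_of_pos (norm_pos_iff.2 (sub_ne_zero.2 h_diag)) _
  have h_nonneg := lpPair_nonneg p ((u z.1, v z.1) - (u z.2, v z.2))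
  rw [h_add, formDensity_self hp, ENNReal.ofReal_eq_ofReal_iff (by positivity) (by positivity),
    div_left_inj' h_weight.ne', Real.rpow_left_inj (abs_nonneg _) h_nonneg hp₀.ne'] at hz
  exact mul_eq_mul_of_abs_lpPair_sub_lpPair_eq hp hz

/-- `u` is a minimizer of the Rayleigh quotient `‖u‖_{s,p}^p / ∫ w |u|^p` among the functions of
`D^{s,p}` for which the denominator is positive; the attained minimum is the first eigenvalue. -/
structure IsMinimizer (s p : ℝ) (w u : ℝᴺ → ℝ) : Prop where
  memD : MemD s p u
  integrable : Integrable (fun x => w x * |u x| ^ p) volume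
  integral_pos : 0 < ∫ x, w x * |u x| ^ p
  energy_eq : energy s p u = firstEigenvalue s p w * ENNReal.ofReal (∫ x, w x * |u x| ^ p)

theorem IsFirstEigenfunction.isMinimizer (hs0 : 0 < s) (hs1 : s < 1) (hp : 1 < p)
    (hsp : s * p < N) {w u : ℝᴺ → ℝ} (hu : IsFirstEigenfunction s p w u) :
    IsMinimizer s p w u := by
  obtain ⟨h_top, huD, hu_ne, hu_test⟩ := hu
  obtain ⟨h_int, h_eq⟩ := hu_test u huD
  simp only [mul_assoc (w _), abs_rpow_sub_two_mul_mul_self hp] at h_int h_eq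
  have hE : energy s p u = firstEigenvalue s p w * ENNReal.ofReal (∫ x, w x * |u x| ^ p) := calc
    energy s p u = ENNReal.ofReal (∫ z, formDensity s p u u z) :=
      (ofReal_integral_formDensity_self hp huD.1 (huD.energy_lt_top hs0 hs1 hp.le)).symm
    _ = _ := by
      simp only [formDensity_self hp, h_eq]
      rw [ENNReal.ofReal_mul ENNReal.toReal_nonneg, ENNReal.ofReal_toReal h_top]
  refine ⟨huD, h_int, not_le.1 fun h_nonpos => ?_, hE⟩
  rw [ENNReal.ofReal_of_nonpos h_nonpos, mul_zero] at hE
  exact hu_ne (huD.ae_eq_zero_of_energy_eq_zero hs0 hp hsp hE)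

theorem IsMinimizer.not_ae_eq_zero (hp : 0 < p) {w u : ℝᴺ → ℝ} (hu : IsMinimizer s p w u) :
    ¬ u =ᵐ[volume] 0 := by
  refine fun h => hu.integral_pos.ne' (integral_eq_zero_of_ae ?_)
  filter_upwards [h] with x hx
  simp [hx, hp.ne']

theorem MemD.firstEigenvalue_mul_le_energy (hp : 0 < p) {w u : ℝᴺ → ℝ} (hu : MemD s p u)
    (h_int : Integrable (fun x => w x * |u x| ^ p) volume) (h_pos : 0 < ∫ x, w x * |u x| ^ p) :
    firstEigenvalue s p w * ENNReal.ofReal (∫ x, w x * |u x| ^ p) ≤ energy s p u := by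
  set m := ∫ x, w x * |u x| ^ p with hm
  let c : ℝ := (m ^ (1 / p))⁻¹
  have hc : |c| ^ p = m⁻¹ := by
    rw [abs_of_pos (by positivity), Real.inv_rpow (by positivity), ← Real.rpow_mul h_pos.le,
      one_div_mul_cancel hp.ne', Real.rpow_one]
  have h_scale (x : ℝᴺ) : w x * |c * u x| ^ p = m⁻¹ * (w x * |u x| ^ p) := by
    rw [abs_mul, Real.mul_rpow (abs_nonneg _) (abs_nonneg _), hc, mul_left_comm]
  have h_le : firstEigenvalue s p w ≤ ENNReal.ofReal m⁻¹ * energy s p u := by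
    rw [← hc, ← energy_const_mul]
    refine iInf₂_le _ ⟨hu.const_mul c, ?_, ?_⟩ <;> simp only [h_scale]
    · exact h_int.const_mul _
    · rw [integral_const_mul, ← hm, inv_mul_cancel₀ h_pos.ne']
  calc firstEigenvalue s p w * ENNReal.ofReal m
      ≤ ENNReal.ofReal m⁻¹ * energy s p u * ENNReal.ofReal m := by gcongr
    _ = energy s p u := by
      rw [mul_right_comm, ← ENNReal.ofReal_mul (by positivity), inv_mul_cancel₀ h_pos.ne',
        ENNReal.ofReal_one, one_mul]

theorem IsMinimizer.ae_mul_eq_mul (hs0 : 0 < s) (hs1 : s < 1) (hp : 1 < p) (hsp : s * p < N)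
    {w u v : ℝᴺ → ℝ} (hu : IsMinimizer s p w u) (hv : IsMinimizer s p w v) :
    ∀ᵐ z : ℝᴺ × ℝᴺ, u z.1 * v z.2 = u z.2 * v z.1 := by
  have hp₀ : 0 < p := zero_lt_one.trans hp
  let σ : ℝᴺ → ℝ := fun x => lpPair p (u x, v x)
  have hσ : MemD s p σ := hu.memD.comp_lipschitzWith₂ hs0 hs1 hp.le hsp hv.memD
    (lipschitzWith_lpPair hp.le) (lpPair_zero hp₀)
  have h_weight : (fun x => w x * |σ x| ^ p) =
      (fun x => w x * |u x| ^ p) + fun x => w x * |v x| ^ p := by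
    ext x
    rw [abs_of_nonneg (lpPair_nonneg _ _), lpPair_rpow hp₀, mul_add, Pi.add_apply]
  have h_integral : ∫ x, w x * |σ x| ^ p = (∫ x, w x * |u x| ^ p) + ∫ x, w x * |v x| ^ p := by
    rw [h_weight, integral_add' hu.integrable hv.integrable]
  refine ae_mul_eq_mul_of_energy_add_le hp hu.memD.1 hv.memD.1
    (hσ.energy_lt_top hs0 hs1 hp.le).ne ?_
  rw [hu.energy_eq, hv.energy_eq, ← mul_add,
    ← ENNReal.ofReal_add hu.integral_pos.le hv.integral_pos.le, ← h_integral]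
  refine hσ.firstEigenvalue_mul_le_energy hp₀ ?_ ?_
  · rw [h_weight]
    exact hu.integrable.add hv.integrable
  · rw [h_integral]
    exact add_pos hu.integral_pos hv.integral_pos

theorem IsMinimizer.exists_const_mul (hs0 : 0 < s) (hs1 : s < 1) (hp : 1 < p) (hsp : s * p < N)
    {w u v : ℝᴺ → ℝ} (hu : IsMinimizer s p w u) (hv : IsMinimizer s p w v) :
    ∃ c : ℝ, c ≠ 0 ∧ ∀ᵐ x ∂volume, u x = c * v x :=
  exists_const_mul_of_ae_mul_eq_mul (hu.not_ae_eq_zero (zero_lt_one.trans hp))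
    (hv.not_ae_eq_zero (zero_lt_one.trans hp)) (hu.ae_mul_eq_mul hs0 hs1 hp hsp hv)

theorem energy_abs_le (hp : 0 ≤ p) (u : ℝᴺ → ℝ) :
    energy s p (fun x => |u x|) ≤ energy s p u := by
  refine lintegral_mono fun z => ENNReal.ofReal_le_ofReal ?_
  gcongr ?_ ^ _ / _
  exact abs_abs_sub_abs_le (u z.1) (u z.2)

theorem IsMinimizer.abs (hs0 : 0 < s) (hs1 : s < 1) (hp : 1 ≤ p) (hsp : s * p < N)
    {w u : ℝᴺ → ℝ} (hu : IsMinimizer s p w u) : IsMinimizer s p w (fun x => |u x|) := by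
  have hp₀ : 0 < p := zero_lt_one.trans_le hp
  have h_memD : MemD s p (fun x => |u x|) := hu.memD.abs hs0 hs1 hp hsp
  have h_int : Integrable (fun x => w x * |(|u x|)| ^ p) volume := by
    simpa only [abs_abs] using hu.integrable
  have h_pos : 0 < ∫ x, w x * |(|u x|)| ^ p := by
    simpa only [abs_abs] using hu.integral_pos
  refine ⟨h_memD, h_int, h_pos,
    ((energy_abs_le hp₀.le u).trans_eq ?_).antisymm
      (h_memD.firstEigenvalue_mul_le_energy hp₀ h_int h_pos)⟩
  simpa only [abs_abs] using hu.energy_eq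

theorem IsMinimizer.ae_nonneg_or_ae_nonpos (hs0 : 0 < s) (hs1 : s < 1) (hp : 1 < p)
    (hsp : s * p < N) {w u : ℝᴺ → ℝ} (hu : IsMinimizer s p w u) :
    (∀ᵐ x ∂volume, 0 ≤ u x) ∨ (∀ᵐ x ∂volume, u x ≤ 0) := by
  obtain ⟨c, -, hc⟩ := hu.exists_const_mul hs0 hs1 hp hsp (hu.abs hs0 hs1 hp.le hsp)
  rcases le_total 0 c with h | h
  · exact .inl (hc.mono fun x hx => hx ▸ mul_nonneg h (abs_nonneg _))
  · exact .inr (hc.mono fun x hx => hx ▸ mul_nonpos_of_nonpos_of_nonneg h (abs_nonneg _))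

theorem MemD.max_sub_mul_zero (hs0 : 0 < s) (hs1 : s < 1) (hp : 1 ≤ p) (hsp : s * p < N)
    {η u : ℝᴺ → ℝ} (hη : MemD s p η) (hu : MemD s p u) (m : ℝ) :
    MemD s p (fun x => max (η x - m * u x) 0) :=
  hη.comp_lipschitzWith₂ hs0 hs1 hp hsp hu (T := fun a => max (a.1 - m * a.2) 0)
    ((LipschitzWith.prod_fst.sub ((lipschitzWith_smul m).comp LipschitzWith.prod_snd)).max_const 0)
    (by simp)

theorem sub_mul_max_sub_max_le {m : ℝ} (hm : 0 ≤ m) (a b e f : ℝ) :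
    (a - b) * (max (e - m * a) 0 - max (f - m * b) 0) ≤ |a - b| * |e - f| := by
  wlog hab : b ≤ a generalizing a b e f
  · have := this b a f e (le_of_not_ge hab)
    rw [abs_sub_comm a, abs_sub_comm e]
    linarith
  rw [abs_of_nonneg (sub_nonneg.2 hab)]
  refine mul_le_mul_of_nonneg_left (sub_le_iff_le_add.2 (max_le ?_ (by positivity)))
    (sub_nonneg.2 hab)
  linarith [le_abs_self (e - f), mul_le_mul_of_nonneg_left hab hm, le_max_left (f - m * b) 0]

theorem formDensity_max_sub_mul_zero_le {m : ℝ} (hm : 0 ≤ m) (u η : ℝᴺ → ℝ) (z : ℝᴺ × ℝᴺ) :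
    formDensity s p u (fun x => max (η x - m * u x) 0) z ≤ |formDensity s p u η z| := by
  rw [abs_formDensity, formDensity, mul_assoc, mul_assoc]
  gcongr ?_ / _
  gcongr ?_ * ?_
  exact sub_mul_max_sub_max_le hm _ _ _ _

theorem tendsto_max_sub_natCast_mul_zero {a b : ℝ} (ha : 0 ≤ a) (hb : 0 ≤ b) :
    Tendsto (fun n : ℕ => max (b - n * a) 0) atTop (𝓝 (if a = 0 then b else 0)) := by
  split_ifs with h
  · simp [h, hb]
  · have h_top : Tendsto (fun n : ℕ => (n : ℝ) * a) atTop atTop :=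
      tendsto_natCast_atTop_atTop.atTop_mul_const (ha.lt_of_ne' h)
    refine tendsto_const_nhds.congr' ?_
    filter_upwards [h_top.eventually_ge_atTop b] with n hn
    exact (max_eq_right (sub_nonpos.2 hn)).symm

theorem sub_mul_ite_sub_ite_nonpos {a b e f : ℝ} (ha : 0 ≤ a) (hb : 0 ≤ b) (he : 0 ≤ e)
    (hf : 0 ≤ f) : (a - b) * ((if a = 0 then e else 0) - if b = 0 then f else 0) ≤ 0 := by
  split_ifs with h₁ h₂ h₂
  · simp [h₁, h₂]
  · rw [h₁, zero_sub, sub_zero]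
    exact mul_nonpos_of_nonpos_of_nonneg (neg_nonpos.2 hb) he
  · rw [h₂, zero_sub, sub_zero]
    exact mul_nonpos_of_nonneg_of_nonpos ha (neg_nonpos.2 hf)
  · simp

theorem IsEigenfunction.tendsto_integral_formDensity (hs0 : 0 < s) (hs1 : s < 1) (hp : 1 ≤ p)
    (hsp : s * p < N) {w u η : ℝᴺ → ℝ} {lam : ℝ} (hu : IsEigenfunction s p w lam u)
    (hu₀ : ∀ᵐ x ∂volume, 0 ≤ u x) (hη : MemD s p η) (hη₀ : ∀ᵐ x ∂volume, 0 ≤ η x) :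
    Tendsto (fun n : ℕ => ∫ z, formDensity s p u (fun x => max (η x - n * u x) 0) z) atTop
      (𝓝 0) := by
  obtain ⟨huD, -, hu_test⟩ := hu
  let g (n : ℕ) (x : ℝᴺ) : ℝ := w x * (|u x| ^ (p - 2) * u x) * max (η x - n * u x) 0
  have hv (n : ℕ) := hu_test _ (hη.max_sub_mul_zero hs0 hs1 hp hsp huD n)
  have h_bound (n : ℕ) : ∀ᵐ x ∂volume, ‖g n x‖ ≤ ‖w x * (|u x| ^ (p - 2) * u x) * η x‖ := by
    filter_upwards [hu₀, hη₀] with x hux hηx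
    rw [norm_mul, norm_mul _ (η x)]
    gcongr
    rw [Real.norm_of_nonneg (le_max_right _ _), Real.norm_of_nonneg hηx]
    exact max_le (sub_le_self _ (by positivity)) hηx
  have h_lim : ∀ᵐ x ∂volume, Tendsto (fun n => g n x) atTop (𝓝 0) := by
    filter_upwards [hu₀, hη₀] with x hux hηx
    convert (tendsto_max_sub_natCast_mul_zero hux hηx).const_mul (w x * (|u x| ^ (p - 2) * u x))
    split_ifs with h <;> simp [h]
  have h_int : Tendsto (fun n => ∫ x, g n x) atTop (𝓝 0) := by
    simpa using tendsto_integral_of_dominated_convergence _ (fun n => (hv n).1.1)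
      (hu_test η hη).1.norm h_bound h_lim
  refine (mul_zero lam ▸ h_int.const_mul lam).congr fun n => (hv n).2.symm

theorem IsEigenfunction.ae_eq_zero_of_pos (hs0 : 0 < s) (hs1 : s < 1) (hp : 1 < p)
    (hsp : s * p < N) {w u η : ℝᴺ → ℝ} {lam : ℝ} (hu : IsEigenfunction s p w lam u)
    (hu₀ : ∀ᵐ x ∂volume, 0 ≤ u x) (hη : MemD s p η) (hη₀ : ∀ᵐ x ∂volume, 0 ≤ η x) :
    ∀ᵐ z : ℝᴺ × ℝᴺ, 0 < u z.1 → u z.2 = 0 → η z.2 = 0 := by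
  let v (n : ℕ) (x : ℝᴺ) : ℝ := max (η x - n * u x) 0
  let ζ (x : ℝᴺ) : ℝ := if u x = 0 then η x else 0
  have h_memD (n : ℕ) : MemD s p (v n) := hη.max_sub_mul_zero hs0 hs1 hp.le hsp hu.1 n
  have h_integrable {f : ℝᴺ → ℝ} (hf : MemD s p f) : Integrable (formDensity s p u f) volume :=
    integrable_formDensity hp hu.1.1 hf.1 (hu.1.energy_lt_top hs0 hs1 hp.le)
      (hf.energy_lt_top hs0 hs1 hp.le)
  have h_nonneg : ∀ᵐ z : ℝᴺ × ℝᴺ, (0 ≤ u z.1 ∧ 0 ≤ η z.1) ∧ 0 ≤ u z.2 ∧ 0 ≤ η z.2 := by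
    rw [Measure.volume_eq_prod]
    exact (Measure.quasiMeasurePreserving_fst.ae (hu₀.and hη₀)).and
      (Measure.quasiMeasurePreserving_snd.ae (hu₀.and hη₀))
  have h_lim : ∀ᵐ z ∂volume, Tendsto (fun n => formDensity s p u (v n) z) atTop
      (𝓝 (formDensity s p u ζ z)) := by
    filter_upwards [h_nonneg] with z hz
    exact (((tendsto_max_sub_natCast_mul_zero hz.1.1 hz.1.2).sub
      (tendsto_max_sub_natCast_mul_zero hz.2.1 hz.2.2)).const_mul _).div_const _
  have h_nonpos : formDensity s p u ζ ≤ᵐ[volume] 0 := by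
    filter_upwards [h_nonneg] with z hz
    have h_opposite : (u z.1 - u z.2) * (ζ z.1 - ζ z.2) ≤ 0 :=
      sub_mul_ite_sub_ite_nonpos hz.1.1 hz.2.1 hz.1.2 hz.2.2
    rw [formDensity, mul_assoc]
    exact div_nonpos_of_nonpos_of_nonneg
      (mul_nonpos_of_nonneg_of_nonpos (by positivity) h_opposite) (by positivity)
  have h_zero := ae_eq_zero_of_tendsto_integral_zero (fun n => h_integrable (h_memD n))
    (h_integrable hη).abs
    (fun n => ae_of_all _ (formDensity_max_sub_mul_zero_le n.cast_nonneg u η)) h_lim h_nonpos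
    (hu.tendsto_integral_formDensity hs0 hs1 hp.le hsp hu₀ hη hη₀)
  filter_upwards [h_zero] with z hz hz₁ hz₂
  rcases formDensity_eq_zero_iff.1 hz with h | h
  · exact absurd (h.trans hz₂) hz₁.ne'
  · simpa [ζ, hz₁.ne', hz₂] using h.symm

theorem IsEigenfunction.ae_pos (hs0 : 0 < s) (hs1 : s < 1) (hp : 1 < p) (hsp : s * p < N)
    {w u : ℝᴺ → ℝ} {lam : ℝ} (hu : IsEigenfunction s p w lam u)
    (hu₀ : ∀ᵐ x ∂volume, 0 ≤ u x) : ∀ᵐ x ∂volume, 0 < u x := by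
  let η (n : ℕ) : ContDiffBump (0 : ℝᴺ) := ⟨n + 1, n + 2, by positivity, by linarith⟩
  have h_dichotomy : ∀ᵐ z : ℝᴺ × ℝᴺ, 0 < u z.1 → u z.2 ≠ 0 := by
    have h_bump (n : ℕ) := hu.ae_eq_zero_of_pos hs0 hs1 hp hsp hu₀
      (memD_of_contDiff (zero_lt_one.trans hp) (η n).contDiff (η n).hasCompactSupport)
      (ae_of_all _ fun _ => (η n).nonneg)
    filter_upwards [ae_all_iff.2 h_bump] with z hz hz₁ hz₂
    obtain ⟨n, hn⟩ := exists_nat_gt ‖z.2‖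
    refine ((η n).pos_of_mem_ball ?_).ne' (hz n hz₁ hz₂)
    rw [mem_ball_zero_iff]
    exact hn.trans (lt_add_of_pos_right (n : ℝ) two_pos)
  rw [Measure.volume_eq_prod] at h_dichotomy
  obtain ⟨x, hux, hx₀, hx⟩ := ((not_eventually.1 hu.2.1).and_eventually
    (hu₀.and (Measure.ae_ae_of_ae_prod h_dichotomy))).exists
  filter_upwards [hu₀, hx] with y hy₀ hy
  exact hy₀.lt_of_ne' (hy (hx₀.lt_of_ne' hux))

end Energy

end FracHardy

theorem mainTheorem7_general (N : ℕ) (s p : ℝ) (hs0 : 0 < s) (hs1 : s < 1) (hp : 1 < p)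
    (hsp : s * p < (N : ℝ)) (w : EuclideanSpace ℝ (Fin N) → ℝ) :
    (∀ u : EuclideanSpace ℝ (Fin N) → ℝ, FracHardy.IsFirstEigenfunction s p w u →
      (∀ᵐ x ∂volume, 0 ≤ u x) ∨ (∀ᵐ x ∂volume, u x ≤ 0)) ∧
    (∀ u : EuclideanSpace ℝ (Fin N) → ℝ, FracHardy.IsFirstEigenfunction s p w u →
      (∀ᵐ x ∂volume, 0 ≤ u x) → ∀ᵐ x ∂volume, 0 < u x) ∧
    (∀ u v : EuclideanSpace ℝ (Fin N) → ℝ, FracHardy.IsFirstEigenfunction s p w u →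
      FracHardy.IsFirstEigenfunction s p w v →
      ∃ c : ℝ, c ≠ 0 ∧ ∀ᵐ x ∂volume, u x = c * v x) := by
  refine ⟨fun u hu => ?_, fun u hu hu₀ => ?_, fun u v hu hv => ?_⟩
  · exact (hu.isMinimizer hs0 hs1 hp hsp).ae_nonneg_or_ae_nonpos hs0 hs1 hp hsp
  · exact hu.2.ae_pos hs0 hs1 hp hsp hu₀
  · exact (hu.isMinimizer hs0 hs1 hp hsp).exists_const_mul hs0 hs1 hp hsp
      (hv.isMinimizer hs0 hs1 hp hsp)

theorem mainTheorem7 (N : ℕ) (s p : ℝ) (hs0 : 0 < s) (hs1 : s < 1) (hp : 1 < p)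
    (hsp : s * p < (N : ℝ)) (w₁ w₂ : EuclideanSpace ℝ (Fin N) → ℝ)
    (hw₁_nonneg : ∀ᵐ x ∂(volume : Measure (EuclideanSpace ℝ (Fin N))), 0 ≤ w₁ x)
    (hw₂_nonneg : ∀ᵐ x ∂(volume : Measure (EuclideanSpace ℝ (Fin N))), 0 ≤ w₂ x)
    (hw₁ : FracHardy.MemHardyZero s p w₁) (hw₂ : LocallyIntegrable w₂ volume) :
    (∀ u : EuclideanSpace ℝ (Fin N) → ℝ, FracHardy.IsFirstEigenfunction s p (w₁ - w₂) u →
      (∀ᵐ x ∂volume, 0 ≤ u x) ∨ (∀ᵐ x ∂volume, u x ≤ 0)) ∧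
    (∀ u : EuclideanSpace ℝ (Fin N) → ℝ, FracHardy.IsFirstEigenfunction s p (w₁ - w₂) u →
      (∀ᵐ x ∂volume, 0 ≤ u x) → ∀ᵐ x ∂volume, 0 < u x) ∧
    (∀ u v : EuclideanSpace ℝ (Fin N) → ℝ, FracHardy.IsFirstEigenfunction s p (w₁ - w₂) u →
      FracHardy.IsFirstEigenfunction s p (w₁ - w₂) v →
      ∃ c : ℝ, c ≠ 0 ∧ ∀ᵐ x ∂volume, u x = c * v x) :=
  mainTheorem7_general N s p hs0 hs1 hp hsp (w₁ - w₂)
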